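/- Let $\mathcal H_A,\mathcal H_B$ be finite-dimensional complex Hilbert spaces, $d_A=\dim\mathcal H_A$, and let $\log$ be the natural logarithm. For a state (positive semidefinite operator of unit trace) $\rho$ let $S(\rho)=-\operatorname{Tr}(\rho\log\rho)$, and for a state $\rho$ on $\mathcal H_A\otimes\mathcal H_B$ with marginal $\rho_B=\operatorname{Tr}_A\rho$ let $S(A|B)_\rho=S(\rho)-S(\rho_B)$. Let $h(\varepsilon)=-\varepsilon\log\varepsilon-(1-\varepsilon)\log(1-\varepsilon)$ and let $\|X\|_1=\operatorname{Tr}\sqrt{X^*X}$ be the trace norm. Let $\rho_1,\rho_2$ be states on $\mathcal H_A\otimes\mathcal H_B$ with equal marginals $\rho_{1,B}=\rho_{2,B}$, and let $\varepsilon\in(0,1)$. If $\frac12\|\rho_1-\rho_2\|_1=\varepsilon$, then $$|S(A|B)_{\rho_1}-S(A|B)_{\rho_2}|\le \varepsilon\log(d_A^2-1)+h(\varepsilon).$$ The same inequality holds if only $\frac12\|\rho_1-\rho_2\|_1\le\varepsilon$, provided that $\varepsilon\le 1-1/d_A^2$. -/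

import Mathlib

open scoped Matrix ComplexOrder

namespace QInfo

noncomputable section

/-- A density matrix (quantum state) on the Hilbert space with orthonormal basis indexed by `n`:
a positive semidefinite complex matrix of unit trace. -/
structure IsState {n : Type*} [Fintype n] (ρ : Matrix n n ℂ) : Prop where
  posSemidef : ρ.PosSemidef
  trace_eq_one : ρ.trace = 1

/-- The trace norm `‖X‖₁ = Tr √(X* X)`. The square root is taken in the functional calculus;
the trace is a nonnegative real number, of which we take the real part. -/
def traceNorm {n : Type*} [Fintype n] [DecidableEq n] (X : Matrix n n ℂ) : ℝ :=
  (cfc Real.sqrt (Xᴴ * X)).trace.re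

/-- The trace distance `½ ‖ρ - σ‖₁`. -/
def traceDist {n : Type*} [Fintype n] [DecidableEq n] (ρ σ : Matrix n n ℂ) : ℝ :=
  (1 / 2) * traceNorm (ρ - σ)

/-- The von Neumann entropy `S(ρ) = -Tr(ρ log ρ)`, with the natural logarithm. The logarithm is
taken in the functional calculus; as `Real.log 0 = 0`, the kernel of `ρ` contributes `0`,
which is the convention `0 log 0 = 0`. -/
def entropy {n : Type*} [Fintype n] [DecidableEq n] (ρ : Matrix n n ℂ) : ℝ :=
  -(ρ * cfc Real.log ρ).trace.re

/-- The marginal `ρ_B = Tr_A ρ` of an operator on `A ⊗ B`, with respect to the product basis. -/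
def marginalB {A B : Type*} [Fintype A] (ρ : Matrix (A × B) (A × B) ℂ) : Matrix B B ℂ :=
  Matrix.of fun b b' => ∑ a, ρ (a, b) (a, b')

/-- The conditional entropy `S(A|B)_ρ = S(ρ) - S(ρ_B)`. -/
def condEntropy {A B : Type*} [Fintype A] [DecidableEq A] [Fintype B] [DecidableEq B]
    (ρ : Matrix (A × B) (A × B) ℂ) : ℝ :=
  entropy ρ - entropy (marginalB ρ)

end

end QInfo

/-! Write `ρ₁ - ρ₂ = P - Q` with `P, Q ≥ 0` orthogonal, so that `Tr P = Tr Q = η` is the trace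
distance. Equal marginals cancel the entropies of `B`, and also give `Tr_A P = Tr_A Q = β`. Write
`S(X) = -Tr X log X` for unnormalized `X ≥ 0` too. Two estimates are added.

(1) `S(ρ₁) - S(ρ₂) ≤ S(P) - S(Q) + h(η)`. Entropy is, up to explicit terms, the integral over `s` of
the truncated trace `∑ min (tᵢ) (c s)` against `ds / s`. It therefore suffices to compare truncated
traces: this is `sum_min_add_sum_min_le`, taken at `a = (1-η)s`, `b = ηs`. The differing weights `1
- η`, `η` and `1` produce exactly `h(η)`; see `sum_negMulLog_le_of_sum_min_le`.

(2) `S(P) - S(Q) ≤ η log (d_A² - 1)`, in `sum_negMulLog_sub_le`. Both `P` and `Q` lie below `D = d_A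
(1 ⊗ β)`. Since `log D` sees only the marginal, `Tr Q log Q ≤ Tr Q log D = Tr P log D ≤ Tr P log P +
η log (d_A² - 1)`. The constant arises because `P` is orthogonal to `Q`, which leaves it only the
mass `Tr (D - Q) = (d_A² - 1) η`.

The version with `≤ ε` follows from monotonicity of the `d_A²`-ary entropy on `[0, 1 - 1/d_A²]`. -/

open Matrix

namespace QInfo

/-! ### Functional calculus, entropy and trace norm in terms of eigenvalues. -/

section Spectral

variable {n : Type*} [Fintype n] [DecidableEq n]

/-- The Hermitian matrix `U diag(t) Uᴴ`. -/
def ofSpectrum (U : Matrix n n ℂ) (t : n → ℝ) : Matrix n n ℂ :=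
  U * diagonal (fun i => (t i : ℂ)) * Uᴴ

theorem ofSpectrum_mul {U : Matrix n n ℂ} (hU : Uᴴ * U = 1) (s t : n → ℝ) :
    ofSpectrum U s * ofSpectrum U t = ofSpectrum U (fun i => s i * t i) := by
  unfold ofSpectrum
  calc _ = U * diagonal (fun i => (s i : ℂ)) * (Uᴴ * U) * diagonal (fun i => (t i : ℂ)) * Uᴴ := by
        simp only [Matrix.mul_assoc]
    _ = _ := by
        rw [hU, Matrix.mul_one, Matrix.mul_assoc U, diagonal_mul_diagonal]
        simp

theorem ofSpectrum_sub (U : Matrix n n ℂ) (s t : n → ℝ) :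
    ofSpectrum U s - ofSpectrum U t = ofSpectrum U (fun i => s i - t i) := by
  unfold ofSpectrum
  rw [← Matrix.sub_mul, ← Matrix.mul_sub, diagonal_sub]
  simp

theorem ofSpectrum_zero (U : Matrix n n ℂ) : ofSpectrum U (fun _ => 0) = 0 := by
  simp [ofSpectrum]

theorem ofSpectrum_one {U : Matrix n n ℂ} (hU : Uᴴ * U = 1) : ofSpectrum U (fun _ => 1) = 1 := by
  simp [ofSpectrum, mul_eq_one_comm.mp hU]

theorem ofSpectrum_conjTranspose (U : Matrix n n ℂ) (t : n → ℝ) :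
    (ofSpectrum U t)ᴴ = ofSpectrum U t := by
  simp [ofSpectrum, Matrix.mul_assoc, diagonal_conjTranspose]
  congr 3
  ext i
  simp

theorem posSemidef_ofSpectrum (U : Matrix n n ℂ) {t : n → ℝ} (ht : ∀ i, 0 ≤ t i) :
    (ofSpectrum U t).PosSemidef :=
  (PosSemidef.diagonal fun i => by simpa using ht i).mul_mul_conjTranspose_same U

theorem trace_mul_ofSpectrum (X U : Matrix n n ℂ) (t : n → ℝ) :
    (X * ofSpectrum U t).trace.re = ∑ i, t i * ((Uᴴ * X * U) i i).re := by
  have : (X * ofSpectrum U t).trace = (Uᴴ * X * U * diagonal (fun i => (t i : ℂ))).trace := by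
    unfold ofSpectrum
    rw [← Matrix.mul_assoc, trace_mul_comm]
    simp only [Matrix.mul_assoc]
  rw [this]
  simp [trace, mul_diagonal, mul_comm]

theorem trace_ofSpectrum {U : Matrix n n ℂ} (hU : Uᴴ * U = 1) (t : n → ℝ) :
    (ofSpectrum U t).trace.re = ∑ i, t i := by
  simpa [hU] using trace_mul_ofSpectrum 1 U t

theorem trace_ofSpectrum_mul_ofSpectrum {U : Matrix n n ℂ} (hU : Uᴴ * U = 1) (s t : n → ℝ) :
    (ofSpectrum U s * ofSpectrum U t).trace.re = ∑ i, s i * t i := by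
  rw [ofSpectrum_mul hU, trace_ofSpectrum hU]

theorem trace_conj {U : Matrix n n ℂ} (hU : Uᴴ * U = 1) (X : Matrix n n ℂ) :
    (Uᴴ * X * U).trace = X.trace := by
  rw [Matrix.mul_assoc, trace_mul_comm, Matrix.mul_assoc, mul_eq_one_comm.mp hU, Matrix.mul_one]

theorem eigenvectorUnitary_conjTranspose_mul_self {A : Matrix n n ℂ} (hA : A.IsHermitian) :
    (hA.eigenvectorUnitary : Matrix n n ℂ)ᴴ * hA.eigenvectorUnitary = 1 :=
  mem_unitaryGroup_iff'.mp hA.eigenvectorUnitary.2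

theorem cfc_eq_ofSpectrum {A : Matrix n n ℂ} (hA : A.IsHermitian) (f : ℝ → ℝ) :
    cfc f A = ofSpectrum hA.eigenvectorUnitary (fun i => f (hA.eigenvalues i)) := by
  rw [hA.cfc_eq, IsHermitian.cfc, Unitary.conjStarAlgAut_apply]
  rfl

theorem eq_ofSpectrum {A : Matrix n n ℂ} (hA : A.IsHermitian) :
    A = ofSpectrum hA.eigenvectorUnitary hA.eigenvalues := by
  conv_lhs => rw [hA.spectral_theorem, Unitary.conjStarAlgAut_apply]
  rfl

theorem entropy_eq_sum {A : Matrix n n ℂ} (hA : A.IsHermitian) :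
    entropy A = ∑ i, Real.negMulLog (hA.eigenvalues i) := by
  have h := eigenvectorUnitary_conjTranspose_mul_self hA
  unfold entropy
  rw [cfc_eq_ofSpectrum hA]
  conv_lhs => enter [1, 1, 1, 1]; rw [eq_ofSpectrum hA]
  rw [trace_ofSpectrum_mul_ofSpectrum h, ← Finset.sum_neg_distrib]
  simp [Real.negMulLog]

theorem traceNorm_eq_sum {A : Matrix n n ℂ} (hA : A.IsHermitian) :
    traceNorm A = ∑ i, |hA.eigenvalues i| := by
  have h := eigenvectorUnitary_conjTranspose_mul_self hA
  have hsq : Aᴴ * A = cfc (fun x : ℝ => x ^ 2) A := by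
    rw [cfc_eq_ofSpectrum hA, hA.eq]
    conv_lhs => rw [eq_ofSpectrum hA]
    rw [ofSpectrum_mul h]
    simp [sq]
  have : cfc Real.sqrt (Aᴴ * A) = cfc (fun x : ℝ => |x|) A := by
    have hA' : IsSelfAdjoint A := hA
    rw [hsq, ← cfc_comp' Real.sqrt (fun x : ℝ => x ^ 2) A]
    simp [Real.sqrt_sq_eq_abs]
  rw [traceNorm, this, cfc_eq_ofSpectrum hA, trace_ofSpectrum h]

theorem trace_mul_re_nonneg {X Y : Matrix n n ℂ} (hX : X.PosSemidef) (hY : Y.PosSemidef) :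
    0 ≤ (X * Y).trace.re := by
  conv_rhs => rw [eq_ofSpectrum hY.1]
  rw [trace_mul_ofSpectrum]
  refine Finset.sum_nonneg fun i _ => mul_nonneg (hY.eigenvalues_nonneg i) ?_
  have := (hX.conjTranspose_mul_mul_same (hY.1.eigenvectorUnitary : Matrix n n ℂ)).diag_nonneg
    (i := i)
  exact (Complex.le_def.mp this).1

end Spectral

/-! ### Truncated traces and their behaviour under perturbation. -/

section Truncation

variable {n : Type*} [Fintype n] [DecidableEq n]

/-- In the eigenbasis the diagonal entries of `P` lie in `[0, 1]`, so each summand on the right is a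
convex combination of `t i` and `a`. With `sum_min_eq_trace`, where the spectral projection attains
equality, this is a variational formula for the truncated trace. -/
theorem sum_min_le_trace {U : Matrix n n ℂ} (hU : Uᴴ * U = 1) (t : n → ℝ) (a : ℝ)
    {P : Matrix n n ℂ} (hP : P.PosSemidef) (hP' : (1 - P).PosSemidef) :
    ∑ i, min (t i) a ≤ ((1 - P) * ofSpectrum U t).trace.re + a * P.trace.re := by
  rw [trace_mul_ofSpectrum, ← trace_conj hU P]
  have hpos : ∀ i, 0 ≤ ((Uᴴ * P * U) i i).re := fun i =>
    (Complex.le_def.mp (hP.conjTranspose_mul_mul_same U).diag_nonneg).1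
  have hpos' : ∀ i, 0 ≤ ((Uᴴ * (1 - P) * U) i i).re := fun i =>
    (Complex.le_def.mp (hP'.conjTranspose_mul_mul_same U).diag_nonneg).1
  have hsum : ∀ i, ((Uᴴ * (1 - P) * U) i i).re = 1 - ((Uᴴ * P * U) i i).re := fun i => by
    simp [Matrix.mul_sub, Matrix.sub_mul, hU]
  simp only [trace, diag_apply, Complex.re_sum, Finset.mul_sum, ← Finset.sum_add_distrib]
  refine Finset.sum_le_sum fun i _ => ?_
  have h1 := hpos i
  have h2 := hpos' i
  rw [hsum] at h2 ⊢
  rcases min_cases (t i) a with ⟨h, h'⟩ | ⟨h, h'⟩ <;> rw [h] <;> nlinarith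

/-- The indicator of the eigenvalues exceeding a threshold. -/
noncomputable def exceeds (t : n → ℝ) (a : ℝ) (i : n) : ℝ := if a < t i then 1 else 0

theorem sum_min_eq_trace {U : Matrix n n ℂ} (hU : Uᴴ * U = 1) (t : n → ℝ) (a : ℝ) :
    ∑ i, min (t i) a = ((1 - ofSpectrum U (exceeds t a)) * ofSpectrum U t).trace.re
      + a * (ofSpectrum U (exceeds t a)).trace.re := by
  rw [← ofSpectrum_one hU, ofSpectrum_sub, trace_ofSpectrum_mul_ofSpectrum hU, trace_ofSpectrum hU,
    Finset.mul_sum, ← Finset.sum_add_distrib]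
  refine Finset.sum_congr rfl fun i _ => ?_
  unfold exceeds
  split_ifs with h
  · simp [min_eq_right h.le]
  · simp [min_eq_left (not_lt.mp h)]

/-- For projections `R` and `T` there is a projection `Y ≤ 1 - T` with `R ≤ T + Y` whose trace is
at most that of `R`; so `T + Y` dominates the join of `R` and `T`. -/
theorem exists_posSemidef_sub_join {U : Matrix n n ℂ} (hU : Uᴴ * U = 1) {r : n → ℝ}
    (hr : ∀ i, r i = 0 ∨ r i = 1) {T : Matrix n n ℂ} (hT : Tᴴ = T) (hTT : T * T = T) :
    ∃ Y : Matrix n n ℂ, Y.PosSemidef ∧ (1 - T - Y).PosSemidef ∧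
      (T + Y - ofSpectrum U r).PosSemidef ∧ Y.trace.re ≤ (ofSpectrum U r).trace.re := by
  set R := ofSpectrum U r with hR
  have hRR : R * R = R := by
    rw [hR, ofSpectrum_mul hU]
    congr 1
    ext i
    rcases hr i with h | h <;> simp [h]
  have hRh : Rᴴ = R := ofSpectrum_conjTranspose U r
  obtain ⟨Q, hQ⟩ : ∃ Q, Q = 1 - T := ⟨_, rfl⟩
  have hQh : Qᴴ = Q := by simp [hQ, hT]
  have hQQ : Q * Q = Q := by
    rw [hQ]; exact IsIdempotentElem.one_sub hTT
  set M := Q * R * Q with hM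
  have hMh : M.IsHermitian := by
    rw [IsHermitian, hM]; simp [hQh, hRh, Matrix.mul_assoc]
  have hV := eigenvectorUnitary_conjTranspose_mul_self hMh
  set V : Matrix n n ℂ := (hMh.eigenvectorUnitary : Matrix n n ℂ)
  set m := hMh.eigenvalues with hm
  have hMV : M = ofSpectrum V m := eq_ofSpectrum hMh
  -- `Y` is the support projection of `(1 - T) R (1 - T)`.
  set y : n → ℝ := fun i => if m i = 0 then 0 else 1 with hy
  set Y := ofSpectrum V y with hY
  have hYh : Yᴴ = Y := ofSpectrum_conjTranspose V y
  have hYY : Y * Y = Y := by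
    rw [hY, ofSpectrum_mul hV]
    congr 1
    ext i
    by_cases h : m i = 0 <;> simp [hy, h]
  have hYM : Y * M = M := by
    rw [hY, hMV, ofSpectrum_mul hV]
    congr 1
    ext i
    by_cases h : m i = 0 <;> simp [hy, h]
  -- As `0⁻¹ = 0`, the second factor is the pseudo-inverse of `M`; the factorization transfers `Q *
  -- M = M` to `Y`.
  have hYinv : Y = M * ofSpectrum V (fun i => (m i)⁻¹) := by
    rw [hY, hMV, ofSpectrum_mul hV]
    congr 1
    ext i
    by_cases h : m i = 0 <;> simp [hy, h]
  have hQM : Q * M = M := by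
    rw [hM, ← Matrix.mul_assoc, ← Matrix.mul_assoc, hQQ]
  have hQY : Q * Y = Y := by
    rw [hYinv, ← Matrix.mul_assoc, hQM]
  have hYQ : Y * Q = Y := by
    have := congrArg conjTranspose hQY
    simpa [hYh, hQh] using this
  have hD : (Q - Y) * (Q - Y) = Q - Y := by
    rw [Matrix.mul_sub, Matrix.sub_mul, Matrix.sub_mul, hQQ, hYQ, hQY, hYY]; simp
  have hDh : (Q - Y)ᴴ = Q - Y := by simp [hQh, hYh]
  have hDQ : (Q - Y) * Q = Q - Y := by rw [Matrix.sub_mul, hQQ, hYQ]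
  have hQD : Q * (Q - Y) = Q - Y := by rw [Matrix.mul_sub, hQQ, hQY]
  -- `Q - Y` projects onto the part of the range of `Q` on which `QRQ` vanishes, hence on which `R`
  -- vanishes.
  have hzero : (R * (Q - Y))ᴴ * (R * (Q - Y)) = 0 := by
    rw [conjTranspose_mul, hDh, hRh]
    calc (Q - Y) * R * (R * (Q - Y)) = (Q - Y) * (R * R) * (Q - Y) := by
          simp only [Matrix.mul_assoc]
      _ = ((Q - Y) * Q) * R * (Q * (Q - Y)) := by rw [hRR, hDQ, hQD]
      _ = (Q - Y) * M * (Q - Y) := by rw [hM]; simp only [Matrix.mul_assoc]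
      _ = 0 := by rw [Matrix.sub_mul, hQM, hYM]; simp
  have hRD : R * (Q - Y) = 0 := conjTranspose_mul_self_eq_zero.mp hzero
  have hX : T + Y = 1 - (Q - Y) := by rw [hQ]; abel
  have hRX : R * (T + Y) = R := by rw [hX, Matrix.mul_sub, hRD]; simp
  have hXh : (T + Y)ᴴ = T + Y := by simp [hT, hYh]
  have hXR : (T + Y) * R = R := by
    have := congrArg conjTranspose hRX
    rwa [conjTranspose_mul, hXh, hRh] at this
  have hXX : (T + Y) * (T + Y) = T + Y := by
    rw [hX]; exact IsIdempotentElem.one_sub hD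
  refine ⟨Y, posSemidef_ofSpectrum V fun i => ?_, ?_, ?_, ?_⟩
  · by_cases h : m i = 0 <;> simp [hy, h]
  · have := posSemidef_conjTranspose_mul_self (Q - Y)
    rwa [hDh, hD, hQ] at this
  · have := posSemidef_conjTranspose_mul_self (T + Y - R)
    rw [conjTranspose_sub, hXh, hRh, Matrix.mul_sub, Matrix.sub_mul, Matrix.sub_mul, hXX, hRX, hXR,
      hRR] at this
    simpa using this
  · have h1 : Y.trace.re = M.rank := by
      rw [hY, trace_ofSpectrum hV, hMh.rank_eq_card_non_zero_eigs, Fintype.card_subtype, hy,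
        Finset.card_filter]
      push_cast
      refine Finset.sum_congr rfl fun i _ => ?_
      by_cases h : m i = 0
      · simp [h, ← hm]
      · simp [h, ← hm]
    have h2 : R.trace.re = Fintype.card {i // (r i : ℂ) ≠ 0} := by
      rw [hR, trace_ofSpectrum hU, Fintype.card_subtype, Finset.card_filter]
      push_cast
      refine Finset.sum_congr rfl fun i _ => ?_
      rcases hr i with h | h <;> simp [h]
    -- Traces of projections are ranks, and multiplication does not increase rank.
    rw [h1, h2, ← rank_diagonal]
    norm_cast
    calc M.rank ≤ (Q * R).rank := rank_mul_le_left _ _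
      _ ≤ R.rank := rank_mul_le_right _ _
      _ ≤ (U * diagonal (fun i => (r i : ℂ))).rank := rank_mul_le_left _ _
      _ ≤ _ := rank_mul_le_right _ _

/-- Truncated traces under a perturbation `Δ = Δ₊ - Δ₋` given by its spectral decomposition. -/
theorem sum_min_add_sum_min_le {U₁ U₂ U : Matrix n n ℂ} (hU₁ : U₁ᴴ * U₁ = 1)
    (hU₂ : U₂ᴴ * U₂ = 1) (hU : Uᴴ * U = 1) {t₁ t₂ δ : n → ℝ} (ht₂ : ∀ i, 0 ≤ t₂ i)
    (h : ofSpectrum U₁ t₁ - ofSpectrum U₂ t₂ = ofSpectrum U δ) {a b : ℝ} (ha : 0 ≤ a)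
    (hb : 0 ≤ b) :
    ∑ i, min (t₁ i) a + ∑ i, min ((δ i)⁻) b ≤
      ∑ i, min (t₂ i) (a + b) + ∑ i, min ((δ i)⁺) a := by
  set p : n → ℝ := fun i => (δ i)⁺
  set q : n → ℝ := fun i => (δ i)⁻
  have hδ : ofSpectrum U δ = ofSpectrum U p - ofSpectrum U q := by
    rw [ofSpectrum_sub]
    congr 1
    ext i
    simp [p, q]
  have hexc : ∀ (t : n → ℝ) (c : ℝ) i, exceeds t c i = 0 ∨ exceeds t c i = 1 := fun t c i => by
    unfold exceeds; split_ifs <;> simp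
  set T := ofSpectrum U (exceeds p a) with hTdef
  have hTT : T * T = T := by
    rw [hTdef, ofSpectrum_mul hU]
    congr 1
    ext i
    rcases hexc p a i with h | h <;> simp [h]
  have hT0 : T.PosSemidef := posSemidef_ofSpectrum U fun i => by
    rcases hexc p a i with h | h <;> simp [h]
  have hTq : T * ofSpectrum U q = 0 := by
    rw [hTdef, ofSpectrum_mul hU, ← ofSpectrum_zero U]
    congr 1
    ext i
    unfold exceeds
    split_ifs with hi
    · have : 0 < δ i := by
        by_contra hn
        have : p i = 0 := posPart_eq_zero.mpr (not_lt.mp hn)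
        linarith
      simp [q, negPart_eq_zero.mpr this.le]
    · simp
  obtain ⟨Y, hY, hXY, hXR, htr⟩ := exists_posSemidef_sub_join hU₂ (hexc t₂ (a + b))
    (ofSpectrum_conjTranspose U (exceeds p a)) hTT
  set R := ofSpectrum U₂ (exceeds t₂ (a + b))
  have hXY' : (1 - (T + Y)).PosSemidef := by rwa [sub_add_eq_sub_sub]
  have hY1 : (1 - Y).PosSemidef := by
    have := hXY.add hT0
    rwa [show 1 - T - Y + T = 1 - Y by abel] at this
  -- `T + Y` is the test operator for `t₁` and `Y` the one for `q`. In the sum of the two bounds the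
  -- `Y`-parts of `Tr (· Q)` cancel, `Tr Y` acquires the factor `a + b`, and `R ≤ T + Y` with `Tr Y
  -- ≤ Tr R` yields the truncation of `t₂` at `a + b`.
  have e1 := sum_min_le_trace hU₁ t₁ a (hT0.add hY) hXY'
  have e2 := sum_min_le_trace hU q b hY hY1
  have e3 := sum_min_eq_trace hU₂ t₂ (a + b)
  have e4 := sum_min_eq_trace hU p a
  have i1 := trace_mul_re_nonneg hXR (posSemidef_ofSpectrum U₂ ht₂)
  have i2 := trace_mul_re_nonneg hY (posSemidef_ofSpectrum U (t := p) fun i => posPart_nonneg _)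
  have i3 : (T * ofSpectrum U q).trace.re = 0 := by rw [hTq]; simp
  have i4 := mul_le_mul_of_nonneg_left htr hb
  have i5 := mul_le_mul_of_nonneg_left htr ha
  have e5 : ofSpectrum U₁ t₁ = ofSpectrum U₂ t₂ + (ofSpectrum U p - ofSpectrum U q) := by
    rw [← hδ, ← h]; abel
  rw [e5] at e1
  change _ ≤ _ + ∑ i, min (p i) a
  change _ + ∑ i, min (q i) b ≤ _
  rw [e3, e4]
  simp only [Matrix.add_mul, Matrix.sub_mul, Matrix.mul_add, Matrix.mul_sub, Matrix.one_mul,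
    trace_add, trace_sub, Complex.add_re, Complex.sub_re] at *
  linarith

end Truncation
-- From truncated traces to entropies by integration.
section Integration

open MeasureTheory intervalIntegral

theorem integral_congr_uIoc {f g : ℝ → ℝ} {a b : ℝ} (h : Set.EqOn f g (Set.uIoc a b)) :
    ∫ s in a..b, f s = ∫ s in a..b, g s :=
  integral_congr_ae (.of_forall fun _ hx => h hx)

/-- The integrand is `c` up to `s = x / c` and `x / s` afterwards; the condition `x ≤ c * L` puts
the break point inside the interval. -/
theorem integral_min_div {x c L : ℝ} (hx : 0 ≤ x) (hc : 0 ≤ c) (hL : 0 < L) (h : x ≤ c * L) :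
    IntervalIntegrable (fun s => min x (c * s) / s) volume 0 L ∧
      ∫ s in (0 : ℝ)..L, min x (c * s) / s =
        x + x * Real.log L + x * Real.log c + Real.negMulLog x := by
  rcases hx.eq_or_lt with rfl | hx
  · have hcongr : Set.EqOn (fun s => min 0 (c * s) / s) (fun _ => (0 : ℝ)) (Set.uIoc 0 L) := by
      intro s hs
      rw [Set.uIoc_of_le hL.le] at hs
      simp [min_eq_left (mul_nonneg hc hs.1.le)]
    refine ⟨(intervalIntegrable_congr hcongr).mpr (by simp), ?_⟩
    rw [integral_congr_uIoc hcongr]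
    simp
  · have hc : 0 < c := by
      rcases hc.eq_or_lt with rfl | hc
      · linarith [zero_mul L]
      · exact hc
    have hm : 0 < x / c := by positivity
    have hmL : x / c ≤ L := by rwa [div_le_iff₀ hc, mul_comm]
    have hcongr₁ : Set.EqOn (fun s => min x (c * s) / s) (fun _ => c) (Set.uIoc 0 (x / c)) := by
      intro s hs
      rw [Set.uIoc_of_le hm.le] at hs
      have : c * s ≤ x := by
        have := (le_div_iff₀ hc).mp hs.2
        linarith
      simp [min_eq_right this, hs.1.ne']
    have hcongr₂ : Set.EqOn (fun s => min x (c * s) / s) (fun s => x * (1 / s))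
        (Set.uIoc (x / c) L) := by
      intro s hs
      rw [Set.uIoc_of_le hmL] at hs
      have : x ≤ c * s := by
        have := (div_lt_iff₀ hc).mp hs.1
        linarith
      simp [min_eq_left this, div_eq_mul_inv]
    have hi₁ : IntervalIntegrable (fun s => min x (c * s) / s) volume 0 (x / c) :=
      (intervalIntegrable_congr hcongr₁).mpr (by simp)
    have hi₂ : IntervalIntegrable (fun s => min x (c * s) / s) volume (x / c) L := by
      refine (intervalIntegrable_congr hcongr₂).mpr (IntervalIntegrable.const_mul ?_ x)
      refine intervalIntegrable_one_div (fun s hs => ?_) (by fun_prop)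
      rw [Set.uIcc_of_le hmL] at hs
      linarith [hs.1]
    refine ⟨hi₁.trans hi₂, ?_⟩
    rw [← integral_add_adjacent_intervals hi₁ hi₂, integral_congr_uIoc hcongr₁,
      integral_congr_uIoc hcongr₂, intervalIntegral.integral_const_mul,
      integral_one_div_of_pos hm hL, Real.log_div hL.ne' hm.ne', Real.log_div hx.ne' hc.ne']
    simp only [intervalIntegral.integral_const, Real.negMulLog, smul_eq_mul]
    field_simp
    ring

theorem sum_integral_min_div {ι : Type*} [Fintype ι] {x : ι → ℝ} {c L m : ℝ} (hx : ∀ i, 0 ≤ x i)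
    (hsum : ∑ i, x i = m) (hc : 0 ≤ c) (hL : 0 < L) (h : m ≤ c * L) :
    IntervalIntegrable (fun s => (∑ i, min (x i) (c * s)) / s) volume 0 L ∧
      ∫ s in (0 : ℝ)..L, (∑ i, min (x i) (c * s)) / s =
        m * (1 + Real.log L + Real.log c) + ∑ i, Real.negMulLog (x i) := by
  have hle : ∀ i, x i ≤ c * L := fun i =>
    (Finset.single_le_sum (fun j _ => hx j) (Finset.mem_univ i)).trans (hsum.le.trans h)
  simp only [Finset.sum_div]
  refine ⟨?_, ?_⟩
  · simpa only [Finset.sum_fn] using IntervalIntegrable.sum Finset.univ fun i _ =>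
      (integral_min_div (hx i) hc hL (hle i)).1
  rw [intervalIntegral.integral_finsetSum fun i _ => (integral_min_div (hx i) hc hL (hle i)).1,
    Finset.sum_congr rfl fun i _ => (integral_min_div (hx i) hc hL (hle i)).2, ← hsum]
  simp only [Finset.sum_add_distrib, ← Finset.sum_mul]
  ring

theorem sum_negMulLog_le_of_sum_min_le {ι : Type*} [Fintype ι] {t₁ t₂ p q : ι → ℝ} {η : ℝ}
    (ht₁ : ∀ i, 0 ≤ t₁ i) (ht₂ : ∀ i, 0 ≤ t₂ i) (hp : ∀ i, 0 ≤ p i) (hq : ∀ i, 0 ≤ q i)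
    (h₁ : ∑ i, t₁ i = 1) (h₂ : ∑ i, t₂ i = 1) (hpη : ∑ i, p i = η) (hqη : ∑ i, q i = η)
    (hη₀ : 0 < η) (hη₁ : η < 1)
    (h : ∀ s, 0 ≤ s → ∑ i, min (t₁ i) ((1 - η) * s) + ∑ i, min (q i) (η * s) ≤
      ∑ i, min (t₂ i) (1 * s) + ∑ i, min (p i) ((1 - η) * s)) :
    ∑ i, Real.negMulLog (t₁ i) - ∑ i, Real.negMulLog (t₂ i) ≤
      ∑ i, Real.negMulLog (p i) - ∑ i, Real.negMulLog (q i) + Real.binEntropy η := by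
  have hη : 0 < 1 - η := by linarith
  -- Any `L` with `(1 - η) L ≥ 1` and `η L ≥ 1` would do: every truncation is then inactive at `s =
  -- L`. The terms in `log L` cancel, both sides having total mass `1 + η`.
  set L := 1 / (1 - η) + 1 / η with hLdef
  have hL : 0 < L := by positivity
  have hL₁ : 1 ≤ (1 - η) * L := by
    have : (1 - η) * L = 1 + (1 - η) * (1 / η) := by rw [hLdef]; field_simp
    rw [this]
    have : 0 ≤ (1 - η) * (1 / η) := by positivity
    linarith
  have hL₂ : 1 ≤ η * L := by
    have : η * L = 1 + η * (1 / (1 - η)) := by rw [hLdef]; field_simp; ring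
    rw [this]
    have : 0 ≤ η * (1 / (1 - η)) := by positivity
    linarith
  have hL₃ : 1 ≤ 1 * L := by nlinarith
  have i₁ := sum_integral_min_div ht₁ h₁ hη.le hL hL₁
  have i₂ := sum_integral_min_div ht₂ h₂ zero_le_one hL hL₃
  have ip := sum_integral_min_div hp hpη hη.le hL (by linarith)
  have iq := sum_integral_min_div hq hqη hη₀.le hL (by linarith)
  have key := intervalIntegral.integral_mono_on hL.le (i₁.1.add iq.1) (i₂.1.add ip.1) fun s hs => by
    rw [← add_div, ← add_div]
    exact div_le_div_of_nonneg_right (h s hs.1) hs.1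
  rw [intervalIntegral.integral_add i₁.1 iq.1, intervalIntegral.integral_add i₂.1 ip.1, i₁.2, i₂.2,
    ip.2, iq.2] at key
  rw [Real.binEntropy_eq_negMulLog_add_negMulLog_one_sub]
  simp only [Real.negMulLog, Real.log_one] at key ⊢
  linarith

end Integration

/-! ### Logarithmic trace inequalities in an eigenbasis of the dominating operator. -/

section Diagonal

variable {n : Type*} [Fintype n] [DecidableEq n]

theorem ofSpectrum_apply_self (W : Matrix n n ℂ) (t : n → ℝ) (j : n) :
    (ofSpectrum W t j j).re = ∑ k, t k * Complex.normSq (W j k) := by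
  rw [ofSpectrum, mul_apply]
  simp only [mul_diagonal, conjTranspose_apply, Complex.re_sum]
  refine Finset.sum_congr rfl fun k _ => ?_
  simp [Complex.normSq_apply]
  ring

theorem sum_normSq_col {W : Matrix n n ℂ} (hW : Wᴴ * W = 1) (k : n) :
    ∑ j, Complex.normSq (W j k) = 1 := by
  have := congrArg Complex.re (congrFun (congrFun hW k) k)
  simp only [mul_apply, conjTranspose_apply, Complex.re_sum, one_apply_eq, Complex.one_re] at this
  rw [← this]
  refine Finset.sum_congr rfl fun j _ => ?_
  simp [Complex.normSq_apply]

/-- A single spectral term `t k |w⟩⟨w|`, with `w` the column `k` of `W`, is already dominated by the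
diagonal operator. -/
theorem mul_normSq_le_of_ofSpectrum_le {W : Matrix n n ℂ} {t l : n → ℝ} (ht : ∀ i, 0 ≤ t i)
    (h : (diagonal (fun i => (l i : ℂ)) - ofSpectrum W t).PosSemidef) (k : n) (x : n → ℂ) :
    t k * Complex.normSq (∑ j, star (W j k) * x j) ≤ ∑ j, l j * Complex.normSq (x j) := by
  have h0 := h.re_dotProduct_nonneg x
  have h1 : (star x ⬝ᵥ (diagonal (fun i => (l i : ℂ))).mulVec x).re =
      ∑ j, l j * Complex.normSq (x j) := by
    simp only [dotProduct, mulVec_diagonal, Complex.re_sum]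
    refine Finset.sum_congr rfl fun j _ => ?_
    simp [Complex.normSq_apply]
    ring
  have h2 : (star x ⬝ᵥ (ofSpectrum W t).mulVec x).re =
      ∑ k, t k * Complex.normSq (∑ j, star (W j k) * x j) := by
    rw [ofSpectrum, ← mulVec_mulVec, ← mulVec_mulVec, dotProduct_mulVec,
      show star x ᵥ* W = star (Wᴴ *ᵥ x) by simp [star_mulVec]]
    simp only [dotProduct, mulVec_diagonal, Complex.re_sum, Pi.star_apply]
    refine Finset.sum_congr rfl fun k _ => ?_
    rw [show ∑ j, star (W j k) * x j = (Wᴴ *ᵥ x) k from rfl]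
    generalize (Wᴴ *ᵥ x) k = z
    simp [Complex.normSq_apply]
    ring
  rw [sub_mulVec, dotProduct_sub, RCLike.re_to_complex, Complex.sub_re, h1, h2] at h0
  have := Finset.single_le_sum (f := fun k => t k * Complex.normSq (∑ j, star (W j k) * x j))
    (fun k _ => mul_nonneg (ht k) (Complex.normSq_nonneg _)) (Finset.mem_univ k)
  linarith

theorem normSq_eq_zero_of_ofSpectrum_le {W : Matrix n n ℂ} {t l : n → ℝ} (ht : ∀ i, 0 ≤ t i)
    (h : (diagonal (fun i => (l i : ℂ)) - ofSpectrum W t).PosSemidef) {k j : n} (hk : 0 < t k)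
    (hj : l j = 0) : Complex.normSq (W j k) = 0 := by
  have := mul_normSq_le_of_ofSpectrum_le ht h k (Pi.single j 1)
  simp only [Pi.single_apply, mul_ite, mul_one, mul_zero, Finset.sum_ite_eq', Finset.mem_univ,
    if_true, apply_ite Complex.normSq, map_one, map_zero, hj] at this
  simp only [Complex.star_def, Complex.normSq_conj] at this
  exact le_antisymm (nonpos_of_mul_nonpos_right this hk) (Complex.normSq_nonneg _)

/-- Operator monotonicity of the logarithm, in the weak form `Tr N log N ≤ Tr N log D` for
`0 ≤ N ≤ D`, in an eigenbasis of `D`. -/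
theorem sum_mul_log_le_of_ofSpectrum_le {W : Matrix n n ℂ} (hW : Wᴴ * W = 1) {t l : n → ℝ}
    (ht : ∀ i, 0 ≤ t i) (hl : ∀ i, 0 ≤ l i)
    (h : (diagonal (fun i => (l i : ℂ)) - ofSpectrum W t).PosSemidef) :
    ∑ k, t k * Real.log (t k) ≤ ∑ j, (ofSpectrum W t j j).re * Real.log (l j) := by
  simp only [ofSpectrum_apply_self, Finset.sum_mul]
  rw [Finset.sum_comm]
  refine Finset.sum_le_sum fun k _ => ?_
  rcases (ht k).eq_or_lt with hk | hk
  · simp [← hk]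
  simp only [mul_assoc]
  rw [← Finset.mul_sum]
  refine mul_le_mul_of_nonneg_left ?_ hk.le
  set w : n → ℝ := fun j => Complex.normSq (W j k) with hw
  have hw0 : ∀ j, 0 ≤ w j := fun j => Complex.normSq_nonneg _
  set m := ∑ j, w j / l j with hm
  have hm0 : 0 ≤ m := Finset.sum_nonneg fun j _ => div_nonneg (hw0 j) (hl j)
  -- Testing at `x = D⁻¹ w`, with `w` the column `k` of `W`, gives `t k * m² ≤ m`. Zero entries of
  -- `l` contribute nothing, by the convention `x / 0 = 0`.
  have htm : t k * m ≤ 1 := by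
    have h1 := mul_normSq_le_of_ofSpectrum_le ht h k (fun j => W j k / l j)
    have h2 : ∑ j, star (W j k) * (W j k / l j) = (m : ℂ) := by
      rw [hm, Complex.ofReal_sum]
      refine Finset.sum_congr rfl fun j _ => ?_
      rw [hw, Complex.ofReal_div, Complex.normSq_eq_conj_mul_self, mul_div_assoc, Complex.star_def]
    have h3 : ∑ j, l j * Complex.normSq (W j k / l j) = m := by
      refine Finset.sum_congr rfl fun j _ => ?_
      rw [Complex.normSq_div, Complex.normSq_ofReal]
      by_cases hj : l j = 0
      · simp [hj]
      · field_simp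
        rfl
    rw [h2, h3, Complex.normSq_ofReal] at h1
    rcases hm0.eq_or_lt with hm0 | hm0
    · rw [← hm0]; simp
    · nlinarith
  -- This is `log u ≤ u - 1` at `u = t k / l j`, weighted by `w j`; where `l j = 0` the weight
  -- vanishes.
  have hterm : ∀ j, w j * Real.log (t k) - w j * Real.log (l j) ≤ t k * (w j / l j) - w j := by
    intro j
    rcases (hl j).eq_or_lt with hj | hj
    · have : w j = 0 := normSq_eq_zero_of_ofSpectrum_le ht h hk hj.symm
      simp [this]
    · have := Real.log_le_sub_one_of_pos (div_pos hk hj)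
      rw [Real.log_div hk.ne' hj.ne'] at this
      have := mul_le_mul_of_nonneg_left this (hw0 j)
      calc _ = w j * (Real.log (t k) - Real.log (l j)) := by ring
        _ ≤ _ := this
        _ = _ := by ring
  have := Finset.sum_le_sum fun j (_ : j ∈ Finset.univ) => hterm j
  simp only [Finset.sum_sub_distrib, ← Finset.sum_mul, ← Finset.mul_sum] at this
  rw [sum_normSq_col hW k, ← hm] at this
  linarith

/-- An upper bound for `Tr N log D - Tr N log N`, where `D` also dominates an operator `M` that is
orthogonal to `N`. -/
theorem sum_log_le_of_orthogonal {W : Matrix n n ℂ} (hW : Wᴴ * W = 1) {t l : n → ℝ}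
    (ht : ∀ i, 0 ≤ t i) (hl : ∀ i, 0 ≤ l i)
    (h : (diagonal (fun i => (l i : ℂ)) - ofSpectrum W t).PosSemidef) {M : Matrix n n ℂ}
    (hM : (diagonal (fun i => (l i : ℂ)) - M).PosSemidef) (hNM : ofSpectrum W t * M = 0) {K : ℝ}
    (hK : 0 < K) (htr : ∑ j, l j - M.trace.re ≤ K * ∑ k, t k) :
    ∑ j, (ofSpectrum W t j j).re * Real.log (l j) ≤
      ∑ k, t k * Real.log (t k) + (∑ k, t k) * Real.log K := by
  set D : Matrix n n ℂ := diagonal (fun i => (l i : ℂ)) with hD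
  set g : n → ℝ := fun k => ((Wᴴ * (D - M) * W) k k).re with hg
  have hg0 : ∀ k, 0 ≤ g k := fun k =>
    (Complex.le_def.mp (hM.conjTranspose_mul_mul_same W).diag_nonneg).1
  have hgsum : ∑ k, g k = ∑ j, l j - M.trace.re := by
    have := congrArg Complex.re (trace_conj hW (D - M))
    rw [trace_sub, Complex.sub_re, hD, trace_diagonal] at this
    simpa [hg, trace] using this
  -- Orthogonality makes `M` vanish on the eigenvectors of `N` with positive eigenvalue, so there
  -- the diagonal entries of `D - M` and `D` agree.
  have hMk : ∀ k, 0 < t k → (Wᴴ * M * W) k k = 0 := by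
    intro k hk
    have h1 : diagonal (fun i => (t i : ℂ)) * (Wᴴ * M * W) = 0 := by
      have : Wᴴ * (ofSpectrum W t * M) * W = 0 := by rw [hNM]; simp
      rw [← this, ofSpectrum]
      simp only [← Matrix.mul_assoc]
      rw [hW, Matrix.one_mul]
    have := congrFun (congrFun h1 k) k
    simpa [diagonal_mul, hk.ne'] using this
  have hgk : ∀ k, 0 < t k → g k = ∑ j, Complex.normSq (W j k) * l j := by
    intro k hk
    simp only [hg, Matrix.mul_sub, Matrix.sub_mul, Matrix.sub_apply, hMk k hk, sub_zero]
    rw [hD, mul_apply]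
    simp only [mul_diagonal, conjTranspose_apply, Complex.re_sum]
    refine Finset.sum_congr rfl fun j _ => ?_
    simp [Complex.normSq_apply]
    ring
  -- This comes from `log u ≤ u - 1` at `u = l j / (K * t k)`. Where `t k = 0` the bound only needs
  -- `g k ≥ 0`, that is `M ≤ D`; keeping these terms makes the `g k` sum to `Tr (D - M)`.
  have hterm : ∀ k, t k * ∑ j, Complex.normSq (W j k) * Real.log (l j) ≤
      t k * Real.log (t k) + t k * Real.log K + g k / K - t k := by
    intro k
    rcases (ht k).eq_or_lt with hk | hk
    · simp only [← hk]
      have := div_nonneg (hg0 k) hK.le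
      simpa using this
    have hj : ∀ j, Complex.normSq (W j k) * Real.log (l j) -
        Complex.normSq (W j k) * Real.log (K * t k) ≤
        Complex.normSq (W j k) * l j / (K * t k) - Complex.normSq (W j k) := by
      intro j
      rcases (hl j).eq_or_lt with hj | hj
      · simp [normSq_eq_zero_of_ofSpectrum_le ht h hk hj.symm]
      · have hKt : 0 < K * t k := mul_pos hK hk
        have := Real.log_le_sub_one_of_pos (div_pos hj hKt)
        rw [Real.log_div hj.ne' hKt.ne'] at this
        have := mul_le_mul_of_nonneg_left this (Complex.normSq_nonneg (W j k))
        calc _ = Complex.normSq (W j k) * (Real.log (l j) - Real.log (K * t k)) := by ring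
          _ ≤ _ := this
          _ = _ := by ring
    have := Finset.sum_le_sum fun j (_ : j ∈ Finset.univ) => hj j
    simp only [Finset.sum_sub_distrib, ← Finset.sum_mul, ← Finset.sum_div] at this
    rw [sum_normSq_col hW k, ← hgk k hk, one_mul, Real.log_mul hK.ne' hk.ne'] at this
    have := mul_le_mul_of_nonneg_left this hk.le
    have e : t k * (g k / (K * t k) - 1) = g k / K - t k := by field_simp
    rw [e] at this
    linarith
  have := Finset.sum_le_sum fun k (_ : k ∈ Finset.univ) => hterm k
  simp only [Finset.sum_sub_distrib, Finset.sum_add_distrib, ← Finset.sum_mul, ← Finset.sum_div,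
    hgsum] at this
  have hdiv : (∑ j, l j - M.trace.re) / K ≤ ∑ k, t k := by
    rw [div_le_iff₀ hK]; linarith
  have e : ∑ j, (ofSpectrum W t j j).re * Real.log (l j) =
      ∑ k, t k * ∑ j, Complex.normSq (W j k) * Real.log (l j) := by
    simp only [ofSpectrum_apply_self, Finset.sum_mul]
    rw [Finset.sum_comm]
    simp only [mul_assoc, Finset.mul_sum]
  rw [e]
  linarith

end Diagonal
-- Partial trace and the bound for orthogonal operators with equal marginals.
section Marginal

open scoped Kronecker

variable {A B : Type*} [Fintype A]

theorem posSemidef_marginalB {X : Matrix (A × B) (A × B) ℂ} (hX : X.PosSemidef) :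
    (marginalB X).PosSemidef := by
  have : marginalB X = ∑ a, X.submatrix (fun b => (a, b)) (fun b => (a, b)) := by
    ext b b'
    simp [marginalB, Matrix.sum_apply]
  rw [this]
  exact posSemidef_sum _ fun a _ => hX.submatrix _

theorem marginalB_sub (X Y : Matrix (A × B) (A × B) ℂ) :
    marginalB (X - Y) = marginalB X - marginalB Y := by
  ext b b'
  simp [marginalB]

/-- With `A` trivial, the marginal determines the operator. -/
theorem two_le_card_of_ne {ρ₁ ρ₂ : Matrix (A × B) (A × B) ℂ}
    (hmarg : marginalB ρ₁ = marginalB ρ₂) (hne : ρ₁ ≠ ρ₂) : 2 ≤ Fintype.card A := by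
  by_contra h
  have : Subsingleton A := Fintype.card_le_one_iff_subsingleton.mp (by omega)
  refine hne (Matrix.ext fun ⟨a, b⟩ ⟨a', b'⟩ => ?_)
  have := congrFun (congrFun hmarg b) b'
  obtain rfl := Subsingleton.elim a a'
  simpa [marginalB, Fintype.sum_subsingleton _ a] using this

variable [Fintype B]

theorem trace_marginalB (X : Matrix (A × B) (A × B) ℂ) : (marginalB X).trace = X.trace := by
  simp only [trace, marginalB, diag_apply, of_apply]
  rw [Fintype.sum_prod_type_right]

variable [DecidableEq A]

/-- This permits passing to an eigenbasis of the common marginal, in which `d_A (1 ⊗ β)` is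
diagonal. -/
theorem marginalB_kronecker_conj (V : Matrix B B ℂ) (X : Matrix (A × B) (A × B) ℂ) :
    marginalB (((1 : Matrix A A ℂ) ⊗ₖ V)ᴴ * X * ((1 : Matrix A A ℂ) ⊗ₖ V)) =
      Vᴴ * marginalB X * V := by
  ext b b'
  simp only [marginalB, of_apply, mul_apply, conjTranspose_apply, kroneckerMap_apply, one_apply,
    Fintype.sum_prod_type, Finset.sum_mul, Finset.mul_sum]
  simp only [ite_mul, one_mul, zero_mul, mul_ite, mul_zero, apply_ite star, star_zero]
  simp only [Finset.sum_ite_irrel, Finset.sum_const_zero, Finset.sum_ite_eq',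
    Finset.mem_univ, if_true]
  rw [Finset.sum_comm]
  refine Finset.sum_congr rfl fun i _ => ?_
  rw [Finset.sum_comm]

variable [DecidableEq B]

/-- The operator `|a⟩⟨a'| ⊗ 1`. -/
def matrixUnit (B : Type*) [DecidableEq B] (a a' : A) : Matrix (A × B) (A × B) ℂ :=
  Matrix.of fun p q => if p.1 = a then (if q = (a', p.2) then 1 else 0) else 0

theorem matrixUnit_conj_apply (X : Matrix (A × B) (A × B) ℂ) (a a' : A) (p q : A × B) :
    (matrixUnit B a a' * X * (matrixUnit B a a')ᴴ) p q =
      if p.1 = a then (if q.1 = a then X (a', p.2) (a', q.2) else 0) else 0 := by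
  by_cases hp : p.1 = a <;> by_cases hq : q.1 = a <;>
    simp [mul_apply, matrixUnit, hp, hq]

theorem one_kronecker_marginalB (X : Matrix (A × B) (A × B) ℂ) :
    (1 : Matrix A A ℂ) ⊗ₖ marginalB X =
      ∑ a, ∑ a', matrixUnit B a a' * X * (matrixUnit B a a')ᴴ := by
  ext ⟨x, b⟩ ⟨y, b'⟩
  simp only [Matrix.sum_apply, matrixUnit_conj_apply, kroneckerMap_apply, marginalB, of_apply,
    one_apply]
  rw [Finset.sum_comm]
  simp only [Finset.sum_ite_eq, Finset.mem_univ, if_true]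
  by_cases h : y = x
  · simp [h]
  · simp [h, Ne.symm h]

/-- The pinching inequality combined with the partial trace: `X ≤ d_A (1 ⊗ Tr_A X)`. -/
theorem posSemidef_card_smul_kronecker_sub {X : Matrix (A × B) (A × B) ℂ} (hX : X.PosSemidef) :
    ((Fintype.card A : ℂ) • ((1 : Matrix A A ℂ) ⊗ₖ marginalB X) - X).PosSemidef := by
  let c : A → A → Matrix (A × B) (A × B) ℂ := fun a a' =>
    diagonal fun p => (if p.1 = a then 1 else 0) - (if p.1 = a' then 1 else 0)
  -- The terms with factor `1 / 2` sum to `d_A` times the block-diagonal part of `X`, minus `X`. The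
  -- off-diagonal matrix units supply `d_A` times the difference between `1 ⊗ Tr_A X` and that
  -- block-diagonal part. Each term is visibly positive.
  have hdec : (Fintype.card A : ℂ) • ((1 : Matrix A A ℂ) ⊗ₖ marginalB X) - X =
      ∑ a, ∑ a', ((1 / 2 : ℂ) • (c a a' * X * (c a a')ᴴ) +
        (if a = a' then (0 : ℂ) else (Fintype.card A : ℂ)) •
          (matrixUnit B a a' * X * (matrixUnit B a a')ᴴ)) := by
    rw [one_kronecker_marginalB]
    let G : A → A → Matrix (A × B) (A × B) ℂ := fun a a' =>
      matrixUnit B a a' * X * (matrixUnit B a a')ᴴ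
    have hG : ∀ a a' p q, G a a' p q =
        if p.1 = a then (if q.1 = a then X (a', p.2) (a', q.2) else 0) else 0 :=
      fun a a' p q => matrixUnit_conj_apply X a a' p q
    ext ⟨x, b⟩ ⟨y, b'⟩
    have h1 : ∑ a, ∑ a', (1 / 2 : ℂ) * (c a a' * X * (c a a')ᴴ) (x, b) (y, b') =
        ((if x = y then (Fintype.card A : ℂ) else 0) - 1) * X (x, b) (y, b') := by
      have hc : ∀ a a', (1 / 2 : ℂ) * (c a a' * X * (c a a')ᴴ) (x, b) (y, b') =
          (1 / 2) * X (x, b) (y, b') *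
          ((if x = a then (if y = a then 1 else 0) else 0)
            - (if x = a then 1 else 0) * (if y = a' then 1 else 0)
            - (if y = a then 1 else 0) * (if x = a' then 1 else 0)
            + (if x = a' then (if y = a' then 1 else 0) else 0)) := by
        intro a a'
        simp only [c, diagonal_conjTranspose, mul_diagonal, diagonal_mul, Pi.star_apply, star_sub,
          apply_ite star, star_one, star_zero]
        split_ifs <;> ring
      simp only [hc, ← Finset.mul_sum, Finset.sum_add_distrib, Finset.sum_sub_distrib,
        Finset.sum_ite_eq, Finset.mem_univ, if_true, Finset.sum_const, Finset.card_univ,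
        nsmul_eq_mul, mul_one, @eq_comm _ y x]
      split_ifs <;> ring
    have h2 : ∑ a, ∑ a', (if a = a' then (0 : ℂ) else (Fintype.card A : ℂ)) *
          G a a' (x, b) (y, b') =
        Fintype.card A * ∑ a, ∑ a', G a a' (x, b) (y, b') -
          (if x = y then (Fintype.card A : ℂ) else 0) * X (x, b) (y, b') := by
      have hs : ∀ a a', (if a = a' then (0 : ℂ) else (Fintype.card A : ℂ)) *
          G a a' (x, b) (y, b') = Fintype.card A * G a a' (x, b) (y, b') -
            (if a = a' then Fintype.card A * G a a' (x, b) (y, b') else 0) := by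
        intro a a'
        split_ifs <;> ring
      simp only [hs, Finset.sum_sub_distrib, ← Finset.mul_sum, Finset.sum_ite_eq, Finset.mem_univ,
        if_true]
      congr 1
      simp only [hG]
      by_cases hxy : x = y
      · simp [hxy]
      · simp [hxy, Ne.symm hxy]
    simp only [Matrix.sub_apply, Matrix.smul_apply, Matrix.sum_apply, Matrix.add_apply, smul_eq_mul,
      Finset.sum_add_distrib]
    rw [h1, h2]
    simp only [G]
    ring
  rw [hdec]
  refine posSemidef_sum _ fun a _ => posSemidef_sum _ fun a' _ => PosSemidef.add ?_ ?_
  · exact (hX.mul_mul_conjTranspose_same _).smul (by norm_num [Complex.le_def])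
  · refine (hX.mul_mul_conjTranspose_same _).smul ?_
    split_ifs
    · exact le_rfl
    · exact Nat.cast_nonneg _

theorem sum_negMulLog_sub_le {U : Matrix (A × B) (A × B) ℂ} (hU : Uᴴ * U = 1) {p q : A × B → ℝ}
    (hp : ∀ i, 0 ≤ p i) (hq : ∀ i, 0 ≤ q i) (hpq : ∀ i, p i * q i = 0)
    (hmarg : marginalB (ofSpectrum U p) = marginalB (ofSpectrum U q))
    (hd : 2 ≤ Fintype.card A) :
    ∑ i, Real.negMulLog (p i) - ∑ i, Real.negMulLog (q i) ≤
      (∑ i, p i) * Real.log ((Fintype.card A : ℝ) ^ 2 - 1) := by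
  set d := Fintype.card A with hddef
  have hβ := posSemidef_marginalB (posSemidef_ofSpectrum U hp)
  have hV := eigenvectorUnitary_conjTranspose_mul_self hβ.1
  set V : Matrix B B ℂ := (hβ.1.eigenvectorUnitary : Matrix B B ℂ)
  set μ := hβ.1.eigenvalues
  have hβV : marginalB (ofSpectrum U p) = ofSpectrum V μ := eq_ofSpectrum hβ.1
  have hμ : ∀ b, 0 ≤ μ b := hβ.eigenvalues_nonneg
  have hsumμ : ∑ b, μ b = ∑ i, p i := by
    rw [← trace_ofSpectrum hV, ← hβV, trace_marginalB, trace_ofSpectrum hU]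
  have hsumq : ∑ i, q i = ∑ i, p i := by
    rw [← trace_ofSpectrum hU, ← trace_ofSpectrum hU, ← trace_marginalB, ← hmarg, trace_marginalB]
  set E : Matrix (A × B) (A × B) ℂ := (1 : Matrix A A ℂ) ⊗ₖ V with hE
  have hEE : Eᴴ * E = 1 := by
    rw [hE, conjTranspose_kronecker, ← mul_kronecker_mul, hV]
    simp
  have hEE' : E * Eᴴ = 1 := mul_eq_one_comm.mp hEE
  set W := Eᴴ * U with hW
  have hWW : Wᴴ * W = 1 := by
    rw [hW, conjTranspose_mul, conjTranspose_conjTranspose, Matrix.mul_assoc, ← Matrix.mul_assoc E,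
      hEE', Matrix.one_mul, hU]
  have hconj : ∀ t, Eᴴ * ofSpectrum U t * E = ofSpectrum W t := fun t => by
    simp [ofSpectrum, hW, Matrix.mul_assoc]
  set l : A × B → ℝ := fun i => d * μ i.2 with hl
  have hl0 : ∀ i, 0 ≤ l i := fun i => mul_nonneg (Nat.cast_nonneg _) (hμ _)
  have hdiag : Vᴴ * ofSpectrum V μ * V = diagonal fun b => (μ b : ℂ) := by
    rw [ofSpectrum]
    simp only [← Matrix.mul_assoc]
    rw [hV, Matrix.one_mul, Matrix.mul_assoc, hV, Matrix.mul_one]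
  have hmW : ∀ t, marginalB (ofSpectrum U t) = ofSpectrum V μ →
      marginalB (ofSpectrum W t) = diagonal fun b => (μ b : ℂ) := fun t ht => by
    rw [← hconj, marginalB_kronecker_conj, ht, hdiag]
  have hle : ∀ t, (∀ i, 0 ≤ t i) → marginalB (ofSpectrum U t) = ofSpectrum V μ →
      (diagonal (fun i => (l i : ℂ)) - ofSpectrum W t).PosSemidef := fun t ht0 ht => by
    have := posSemidef_card_smul_kronecker_sub (posSemidef_ofSpectrum W ht0)
    rw [hmW t ht] at this
    convert this using 2
    rw [← diagonal_one, diagonal_kronecker_diagonal, ← diagonal_smul]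
    congr 1
    ext i
    simp [hl, hddef]
  -- `l` depends only on the `B` index, so the expectation of `log D` is a function of the marginal
  -- alone.
  have hlog : ∀ t, marginalB (ofSpectrum U t) = ofSpectrum V μ →
      ∑ i, (ofSpectrum W t i i).re * Real.log (l i) = ∑ b, μ b * Real.log (d * μ b) :=
    fun t ht => by
      rw [Fintype.sum_prod_type_right]
      refine Finset.sum_congr rfl fun b _ => ?_
      have := congrArg Complex.re (congrFun (congrFun (hmW t ht) b) b)
      simp only [marginalB, of_apply, Complex.re_sum, diagonal_apply_eq, Complex.ofReal_re] at this
      rw [← this, Finset.sum_mul]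
      simp [this, hl]
  have hq' : marginalB (ofSpectrum U q) = ofSpectrum V μ := hmarg.symm.trans hβV
  have h1 := sum_mul_log_le_of_ofSpectrum_le hWW hq hl0 (hle q hq hq')
  have hd' : (2 : ℝ) ≤ d := by exact_mod_cast hd
  have hsuml : ∑ i, l i = d ^ 2 * ∑ i, p i := by
    rw [hl, Fintype.sum_prod_type]
    dsimp only
    rw [Finset.sum_const, ← Finset.mul_sum, hsumμ, Finset.card_univ,
      ← hddef, nsmul_eq_mul]
    ring
  -- `K = d² - 1` since `Tr D = d² ∑ p` and the orthogonal operator takes away `∑ q = ∑ p`.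
  have h2 := sum_log_le_of_orthogonal hWW hp hl0 (hle p hp hβV) (hle q hq hq')
    (by rw [ofSpectrum_mul hWW]; simp [hpq, ofSpectrum_zero]) (K := (d : ℝ) ^ 2 - 1)
    (by nlinarith) (by rw [trace_ofSpectrum hWW, hsuml, hsumq]; linarith)
  rw [hlog q hq'] at h1
  rw [hlog p hβV] at h2
  simp only [Real.negMulLog, neg_mul, Finset.sum_neg_distrib]
  linarith

end Marginal

/-! ### Assembly for states. -/

section Main

variable {A B : Type*} [Fintype A] [DecidableEq A] [Fintype B] [DecidableEq B]

theorem sum_eigenvalues_eq_one {n : Type*} [Fintype n] [DecidableEq n] {ρ : Matrix n n ℂ}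
    (hρ : IsState ρ) : ∑ i, hρ.posSemidef.1.eigenvalues i = 1 := by
  rw [← trace_ofSpectrum (eigenvectorUnitary_conjTranspose_mul_self hρ.posSemidef.1),
    ← eq_ofSpectrum, hρ.trace_eq_one, Complex.one_re]

theorem traceDist_comm {n : Type*} [Fintype n] [DecidableEq n] (ρ σ : Matrix n n ℂ) :
    traceDist ρ σ = traceDist σ ρ := by
  rw [traceDist, traceDist, ← neg_sub σ ρ, traceNorm, traceNorm, conjTranspose_neg, neg_mul_neg]

theorem condEntropy_sub_le {ρ₁ ρ₂ : Matrix (A × B) (A × B) ℂ} (hρ₁ : IsState ρ₁)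
    (hρ₂ : IsState ρ₂) (hmarg : marginalB ρ₁ = marginalB ρ₂) (hd : 2 ≤ Fintype.card A)
    (h₀ : 0 < traceDist ρ₁ ρ₂) (h₁ : traceDist ρ₁ ρ₂ < 1) :
    condEntropy ρ₁ - condEntropy ρ₂ ≤
      traceDist ρ₁ ρ₂ * Real.log ((Fintype.card A : ℝ) ^ 2 - 1) +
        Real.binEntropy (traceDist ρ₁ ρ₂) := by
  have hH : (ρ₁ - ρ₂).IsHermitian := hρ₁.posSemidef.1.sub hρ₂.posSemidef.1
  have hU := eigenvectorUnitary_conjTranspose_mul_self hH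
  have hU₁ := eigenvectorUnitary_conjTranspose_mul_self hρ₁.posSemidef.1
  have hU₂ := eigenvectorUnitary_conjTranspose_mul_self hρ₂.posSemidef.1
  have hnorm : traceDist ρ₁ ρ₂ = (1 / 2) * ∑ i, |hH.eigenvalues i| := by
    rw [traceDist, traceNorm_eq_sum hH]
  set η := traceDist ρ₁ ρ₂
  set U : Matrix (A × B) (A × B) ℂ := (hH.eigenvectorUnitary : Matrix (A × B) (A × B) ℂ)
  set δ := hH.eigenvalues
  set p : A × B → ℝ := fun i => (δ i)⁺
  set q : A × B → ℝ := fun i => (δ i)⁻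
  have hp : ∀ i, 0 ≤ p i := fun i => posPart_nonneg _
  have hq : ∀ i, 0 ≤ q i := fun i => negPart_nonneg _
  have hsub : ∀ i, p i - q i = δ i := fun i => posPart_sub_negPart _
  have hadd : ∀ i, p i + q i = |δ i| := fun i => posPart_add_negPart _
  have hpq : ∀ i, p i * q i = 0 := fun i => by
    rcases le_total (δ i) 0 with h | h
    · simp [p, posPart_eq_zero.mpr h]
    · simp [q, negPart_eq_zero.mpr h]
  have hΔ : ρ₁ - ρ₂ = ofSpectrum U δ := eq_ofSpectrum hH
  have hδ : ∑ i, δ i = 0 := by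
    rw [← trace_ofSpectrum hU, ← hΔ, trace_sub, hρ₁.trace_eq_one, hρ₂.trace_eq_one]
    simp
  have e1 : ∑ i, p i - ∑ i, q i = 0 := by
    rw [← Finset.sum_sub_distrib, ← hδ]; simp only [hsub]
  have e2 : ∑ i, p i + ∑ i, q i = 2 * η := by
    rw [← Finset.sum_add_distrib, hnorm]; simp only [hadd]; ring
  have hpη : ∑ i, p i = η := by linarith
  have hqη : ∑ i, q i = η := by linarith
  have hm : marginalB (ofSpectrum U p) = marginalB (ofSpectrum U q) := by
    rw [← sub_eq_zero, ← marginalB_sub, ofSpectrum_sub]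
    simp only [hsub]
    rw [← hΔ, marginalB_sub, hmarg, sub_self]
  -- The truncation levels `(1 - η) s` and `η s` add up to `s`, the level for `ρ₂`.
  have hmain := sum_negMulLog_le_of_sum_min_le hρ₁.posSemidef.eigenvalues_nonneg
    hρ₂.posSemidef.eigenvalues_nonneg hp hq (sum_eigenvalues_eq_one hρ₁)
    (sum_eigenvalues_eq_one hρ₂) hpη hqη h₀ h₁ fun s hs => by
      have := sum_min_add_sum_min_le hU₁ hU₂ hU hρ₂.posSemidef.eigenvalues_nonneg
        (by rw [← eq_ofSpectrum, ← eq_ofSpectrum, hΔ])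
        (mul_nonneg (sub_nonneg.mpr h₁.le) hs) (mul_nonneg h₀.le hs)
      rwa [show (1 - η) * s + η * s = 1 * s by ring] at this
  have hlog := sum_negMulLog_sub_le hU hp hq hpq hm hd
  rw [hpη] at hlog
  rw [condEntropy, condEntropy, hmarg, entropy_eq_sum hρ₁.posSemidef.1,
    entropy_eq_sum hρ₂.posSemidef.1]
  linarith

theorem abs_condEntropy_sub_le {ρ₁ ρ₂ : Matrix (A × B) (A × B) ℂ} (hρ₁ : IsState ρ₁)
    (hρ₂ : IsState ρ₂) (hmarg : marginalB ρ₁ = marginalB ρ₂) (hd : 2 ≤ Fintype.card A)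
    (h₀ : 0 < traceDist ρ₁ ρ₂) (h₁ : traceDist ρ₁ ρ₂ < 1) :
    |condEntropy ρ₁ - condEntropy ρ₂| ≤
      traceDist ρ₁ ρ₂ * Real.log ((Fintype.card A : ℝ) ^ 2 - 1) +
        Real.binEntropy (traceDist ρ₁ ρ₂) := by
  refine abs_sub_le_iff.mpr ⟨condEntropy_sub_le hρ₁ hρ₂ hmarg hd h₀ h₁, ?_⟩
  rw [traceDist_comm] at h₀ h₁ ⊢
  exact condEntropy_sub_le hρ₂ hρ₁ hmarg.symm hd h₀ h₁

theorem traceDist_nonneg {ρ₁ ρ₂ : Matrix (A × B) (A × B) ℂ} (hρ₁ : IsState ρ₁)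
    (hρ₂ : IsState ρ₂) : 0 ≤ traceDist ρ₁ ρ₂ := by
  rw [traceDist, traceNorm_eq_sum (hρ₁.posSemidef.1.sub hρ₂.posSemidef.1)]
  exact mul_nonneg (by norm_num) (Finset.sum_nonneg fun i _ => abs_nonneg _)

theorem eq_of_traceDist_eq_zero {ρ₁ ρ₂ : Matrix (A × B) (A × B) ℂ} (hρ₁ : IsState ρ₁)
    (hρ₂ : IsState ρ₂) (h : traceDist ρ₁ ρ₂ = 0) : ρ₁ = ρ₂ := by
  have hH := hρ₁.posSemidef.1.sub hρ₂.posSemidef.1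
  rw [traceDist, traceNorm_eq_sum hH, mul_eq_zero, or_iff_right (by norm_num),
    Finset.sum_eq_zero_iff_of_nonneg fun i _ => abs_nonneg _] at h
  rw [← sub_eq_zero, eq_ofSpectrum hH, ← ofSpectrum_zero]
  congr 1
  ext i
  exact abs_eq_zero.mp (h i (Finset.mem_univ i))

theorem traceDist_self {n : Type*} [Fintype n] [DecidableEq n] (ρ : Matrix n n ℂ) :
    traceDist ρ ρ = 0 := by
  simp [traceDist, traceNorm]

end Main

end QInfo

theorem theorem2 {A B : Type*} [Fintype A] [DecidableEq A] [Fintype B] [DecidableEq B]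
    (ρ₁ ρ₂ : Matrix (A × B) (A × B) ℂ) (hρ₁ : QInfo.IsState ρ₁) (hρ₂ : QInfo.IsState ρ₂)
    (hmarg : QInfo.marginalB ρ₁ = QInfo.marginalB ρ₂)
    (ε : ℝ) (hε₀ : 0 < ε) (hε₁ : ε < 1) :
    (QInfo.traceDist ρ₁ ρ₂ = ε →
      |QInfo.condEntropy ρ₁ - QInfo.condEntropy ρ₂|
        ≤ ε * Real.log ((Fintype.card A : ℝ) ^ 2 - 1) + Real.binEntropy ε) ∧
    (QInfo.traceDist ρ₁ ρ₂ ≤ ε → ε ≤ 1 - 1 / (Fintype.card A : ℝ) ^ 2 →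
      |QInfo.condEntropy ρ₁ - QInfo.condEntropy ρ₂|
        ≤ ε * Real.log ((Fintype.card A : ℝ) ^ 2 - 1) + Real.binEntropy ε) := by
  have main : 0 < QInfo.traceDist ρ₁ ρ₂ → QInfo.traceDist ρ₁ ρ₂ < 1 →
      |QInfo.condEntropy ρ₁ - QInfo.condEntropy ρ₂| ≤
        QInfo.traceDist ρ₁ ρ₂ * Real.log ((Fintype.card A : ℝ) ^ 2 - 1) +
          Real.binEntropy (QInfo.traceDist ρ₁ ρ₂) := fun h₀ h₁ =>
    QInfo.abs_condEntropy_sub_le hρ₁ hρ₂ hmarg (QInfo.two_le_card_of_ne hmarg fun h => by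
      rw [h, QInfo.traceDist_self] at h₀; exact lt_irrefl _ h₀) h₀ h₁
  refine ⟨fun h => ?_, fun h hε => ?_⟩
  · subst h
    exact main hε₀ hε₁
  · set d := Fintype.card A
    have hd : 2 ≤ d := by
      -- The case `d = 0` has to be excluded through the unit trace: as `1 / 0 = 0`, the bound on
      -- `ε` would not rule it out.
      have hne : Nonempty A := by
        by_contra hA
        rw [not_nonempty_iff] at hA
        have := hρ₁.trace_eq_one
        simp [Matrix.trace] at this
      by_contra hlt
      have : d = 1 := by
        have : 0 < d := Fintype.card_pos
        omega
      rw [this] at hε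
      norm_num at hε
      linarith
    have hη := QInfo.traceDist_nonneg hρ₁ hρ₂
    have hq : ∀ x, Real.qaryEntropy (d ^ 2) x = x * Real.log ((d : ℝ) ^ 2 - 1) + Real.binEntropy x :=
      fun x => by simp [Real.qaryEntropy]
    have hmono : Real.qaryEntropy (d ^ 2) (QInfo.traceDist ρ₁ ρ₂) ≤ Real.qaryEntropy (d ^ 2) ε := by
      refine (Real.qaryEntropy_strictMonoOn (by nlinarith)).monotoneOn ?_ ?_ h
      · exact ⟨hη, by push_cast; exact h.trans hε⟩
      · exact ⟨hε₀.le, by push_cast; exact hε⟩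
    rw [hq, hq] at hmono
    refine le_trans ?_ hmono
    -- At distance zero the states coincide; `main` covers only positive distance.
    rcases hη.eq_or_lt with h0 | h0
    · rw [QInfo.eq_of_traceDist_eq_zero hρ₁ hρ₂ h0.symm, QInfo.traceDist_self]
      simp
    · exact main h0 (h.trans_lt hε₁)
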